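/- **Setting.** Let $F=(f_1,\dots,f_N)$ be a polynomial vector field on $\mathbb R^N$ and, for $p\in\mathbb R[x]=\mathbb R[x_1,\dots,x_N]$, let $\mathcal L(p)=\sum_{i=1}^N \frac{\partial p}{\partial x_i}f_i$ be its Lie derivative along $F$. For $x_0\in\mathbb R^N$ let $x(t;x_0)$ be the time trajectory of $\dot x=F(x)$, $x(0)=x_0$, that is, the sum of the Taylor series at $0$ of the solution, defined on the largest symmetric open interval $D_{x_0}$ on which that series converges. For $\psi,\phi\subseteq\mathbb R^N$ write $\psi\Rightarrow[F]\,\phi$ if $x(t;x_0)\in\phi$ for all $x_0\in\psi$ and all $t\in D_{x_0}$. For $P\subseteq\mathbb R[x]$ let $\mathbf V(P)\subseteq\mathbb R^N$ be its set of common real zeros, and for $A\subseteq\mathbb R^N$ let $\mathrm{Id}(A)$ be the ideal of polynomials vanishing on $A$. For an algebraic variety $\psi\subseteq\mathbb R^N$ let $\phi_\psi$ be the smallest algebraic variety $\phi$ with $\psi\Rightarrow[F]\,\phi$, and $I_\psi=\mathrm{Id}(\phi_\psi)$. An ideal $J$ of $\mathbb R[x]$ is *invariant* if $\mathcal L(p)\in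 J$ for all $p\in J$. A *template* $\pi$ is a polynomial in $x$ whose coefficients are linear expressions (without constant term) in parameters $a=(a_1,\dots,a_n)$; for $v\in\mathbb R^n$, $\pi[v]\in\mathbb R[x]$ is obtained by replacing $a$ with $v$, and $\pi[S]=\{\pi[v]:v\in S\}$ for $S\subseteq\mathbb R^n$. Let $\pi^{(j)}$ be the $j$-th formal Lie derivative of $\pi$, where the parameters are treated as constants. Fix an elimination order for the parameters on the monomials of $\mathbb R[a,x]$ (every monomial containing a parameter is greater than every monomial in $x$ alone; for example a lexicographic order with $a_i>x_j$ for all $i,j$). **The algorithm POST.** Given a template $\pi$ and a Gröbner basis $G\subseteq\mathbb R[x]$ of an ideal of $\mathbb R[x]$, with respect to the restriction of the order to the monomials in $x$, let $r_j=\pi^{(j)}\bmod G$ (multivariate division in $\mathbb R[a,x]$) and, for $i\ge 0$, $$V_i=\{v\in\mathbb R^n : r_j[v]=0 \text{ for } j=0,\dots,i\},\qquad J_i=\Big\langle \bigcup_{j=0}^i \pi^{(j)}[V_i]\Big\rangle .$$ POST returns $(V,J)=(V_m,J_m)$ for the least $m\ge 0$ such that $V_{m+1}=V_m$ and $J_{m+1}=J_m$.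 **Theorem (soundness).** Let $\psi\subseteq\mathbb R^N$ be an algebraic variety, $\pi$ a template, $I\subseteq\mathrm{Id}(\psi)$ any ideal of $\mathbb R[x]$, and $G$ a Gröbner basis of $I$. Then POST run with $\pi$ and $G$ stops (such an $m$ exists), and the returned pair $(V,J)$ satisfies: (a) $\pi[V]\subseteq\pi[\mathbb R^n]\cap I_\psi$, and $\psi\Rightarrow[F]\,\mathbf V(\pi[V])$; (b) $J$ is an invariant ideal and $\pi[V]\subseteq J\subseteq I_\psi$. -/

import Mathlib

open MvPolynomial

namespace PolySafety

/-! ### Vector fields, time trajectories, safety assertions -/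

/-- A polynomial vector field on `ℝ^N`. -/
abbrev VectorField (N : ℕ) := Fin N → MvPolynomial (Fin N) ℝ

/-- The vector field as a function `ℝ^N → ℝ^N`. -/
noncomputable def VectorField.toFun {N : ℕ} (F : VectorField N) (x : Fin N → ℝ) : Fin N → ℝ :=
  fun i => eval x (F i)

/-- The Lie derivative `∑ i, (∂p/∂x_i) * f_i` of a polynomial along `F`. -/
noncomputable def lie {N : ℕ} (F : VectorField N) (p : MvPolynomial (Fin N) ℝ) :
    MvPolynomial (Fin N) ℝ :=
  ∑ i, pderiv i p * F i

/-- `x` is the time trajectory of the initial value problem `x' = F(x)`, `x(0) = x₀`, and `s` is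
its Taylor expansion at `0`: `x` solves the problem on an open interval around `0` (its values
there determine `s`), and it equals the sum of `s` on the whole symmetric open interval of
convergence `timeDomain s` of `s`. The values of `x` outside that interval are irrelevant. -/
structure IsTimeTrajectory {N : ℕ} (F : VectorField N) (x₀ : Fin N → ℝ) (x : ℝ → Fin N → ℝ)
    (s : FormalMultilinearSeries ℝ ℝ (Fin N → ℝ)) : Prop where
  initial : x 0 = x₀
  solves : ∃ ε > (0 : ℝ), ∀ t ∈ Set.Ioo (-ε) ε, HasDerivAt x (F.toFun (x t)) t
  taylor : HasFPowerSeriesOnBall x s 0 s.radius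

/-- The largest symmetric open interval on which the (vector valued) power series `s` converges;
it is all of `ℝ` if the radius of convergence is infinite. -/
def timeDomain {N : ℕ} (s : FormalMultilinearSeries ℝ ℝ (Fin N → ℝ)) : Set ℝ :=
  Metric.eball 0 s.radius

/-- The safety assertion `ψ ⟹ [F] φ`: every time trajectory starting in `ψ` stays in `φ`. -/
def Safe {N : ℕ} (F : VectorField N) (ψ φ : Set (Fin N → ℝ)) : Prop :=
  ∀ x₀ ∈ ψ, ∀ x s, IsTimeTrajectory F x₀ x s → ∀ t ∈ timeDomain s, x t ∈ φ

/-! ### Varieties, strongest postcondition, invariant ideals -/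

/-- The set of common real zeros of a set of polynomials. -/
def variety {N : ℕ} (P : Set (MvPolynomial (Fin N) ℝ)) : Set (Fin N → ℝ) :=
  {x | ∀ p ∈ P, eval x p = 0}

/-- Real algebraic varieties. -/
def IsVariety {N : ℕ} (A : Set (Fin N → ℝ)) : Prop :=
  ∃ P : Set (MvPolynomial (Fin N) ℝ), A = variety P

/-- The smallest algebraic variety `φ` such that `ψ ⟹ [F] φ`. -/
def strongestPost {N : ℕ} (F : VectorField N) (ψ : Set (Fin N → ℝ)) : Set (Fin N → ℝ) :=
  ⋂₀ {φ | IsVariety φ ∧ Safe F ψ φ}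

/-- The ideal `I_ψ` of all polynomials that vanish on the strongest postcondition of `ψ`. -/
noncomputable def postIdeal {N : ℕ} (F : VectorField N) (ψ : Set (Fin N → ℝ)) :
    Ideal (MvPolynomial (Fin N) ℝ) :=
  vanishingIdeal ℝ (strongestPost F ψ)

/-- Invariant ideals for `F`: closed under the Lie derivative. -/
def IsInvariantIdeal {N : ℕ} (F : VectorField N) (J : Ideal (MvPolynomial (Fin N) ℝ)) : Prop :=
  ∀ p ∈ J, lie F p ∈ J

/-! ### Multivariate division and Gröbner bases -/

/-- `r` is a remainder of the multivariate division of `p` by the set `G`: `p = ∑ h_g g + r`, no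
`h_g g` has larger multidegree than `p`, and no monomial of `r` is divisible by the leading
monomial of a nonzero element of `G`. -/
def IsRemainder {σ : Type*} (m : MonomialOrder σ) (G : Set (MvPolynomial σ ℝ))
    (p r : MvPolynomial σ ℝ) : Prop :=
  (∃ h : G →₀ MvPolynomial σ ℝ,
    p = (h.sum fun g q => q * (g : MvPolynomial σ ℝ)) + r ∧
    ∀ g : G, m.toSyn (m.degree (h g * (g : MvPolynomial σ ℝ))) ≤ m.toSyn (m.degree p)) ∧
  ∀ d ∈ r.support, ∀ g ∈ G, g ≠ 0 → ¬ m.degree g ≤ d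

/-- Multivariate division is always possible. -/
theorem exists_isRemainder {σ : Type*} (m : MonomialOrder σ) (G : Set (MvPolynomial σ ℝ))
    (p : MvPolynomial σ ℝ) : ∃ r, IsRemainder m G p r := by
  classical
  obtain ⟨h, r, h1, h2, h3⟩ := m.div (b := fun g : {g : G // (g : MvPolynomial σ ℝ) ≠ 0} =>
    (g.1 : MvPolynomial σ ℝ))
    (fun g => (m.leadingCoeff_ne_zero_iff.mpr g.2).isUnit) p
  refine ⟨r, ⟨h.embDomain (Function.Embedding.subtype _), ?_, fun g => ?_⟩,
    fun d hd g hg hg0 => h3 d hd ⟨⟨g, hg⟩, hg0⟩⟩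
  · rw [Finsupp.sum_embDomain]
    exact h1
  · by_cases hg : (g : MvPolynomial σ ℝ) = 0
    · simp [hg]
    · have := h2 ⟨g, hg⟩
      rw [mul_comm] at this
      have e : (h.embDomain (Function.Embedding.subtype _)) g = h ⟨g, hg⟩ :=
        Finsupp.embDomain_apply_self (Function.Embedding.subtype _) h ⟨g, hg⟩
      rw [e]
      exact this

/-- The remainder `p mod G` of multivariate division. (It is unique if `G` is a Gröbner basis.) -/
noncomputable def remainder {σ : Type*} (m : MonomialOrder σ) (G : Set (MvPolynomial σ ℝ))
    (p : MvPolynomial σ ℝ) : MvPolynomial σ ℝ :=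
  Classical.choose (exists_isRemainder m G p)

/-- `G` is a Gröbner basis of `I`: a finite basis of `I` such that a polynomial is in `I` iff its
division by `G` leaves remainder zero. -/
structure IsGroebnerBasis {σ : Type*} (m : MonomialOrder σ) (G : Set (MvPolynomial σ ℝ))
    (I : Ideal (MvPolynomial σ ℝ)) : Prop where
  finite : G.Finite
  span_eq : Ideal.span G = I
  mem_iff : ∀ p r, IsRemainder m G p r → (p ∈ I ↔ r = 0)

/-! ### Monomial orders on parameters and variables

`Sum.inl i` stands for the parameter `a_i`, and `Sum.inr j` for the variable `x_j`. -/

/-- An elimination order for the parameters: each monomial in which some parameter occurs is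
greater than each monomial in the variables alone. -/
def IsEliminationOrder {n N : ℕ} (m : MonomialOrder (Fin n ⊕ Fin N)) : Prop :=
  ∀ d e : Fin n ⊕ Fin N →₀ ℕ, (∀ i, d (Sum.inl i) = 0) → (∃ i, e (Sum.inl i) ≠ 0) →
    m.toSyn d < m.toSyn e

/-- Monomials in the variables, seen as monomials in parameters and variables, and compared
there. -/
noncomputable def varsHom {n N : ℕ} (m : MonomialOrder (Fin n ⊕ Fin N)) :
    (Fin N →₀ ℕ) →+ m.syn :=
  m.toSyn.toAddMonoidHom.comp (Finsupp.mapDomain.addMonoidHom Sum.inr)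

theorem varsHom_injective {n N : ℕ} (m : MonomialOrder (Fin n ⊕ Fin N)) :
    Function.Injective (varsHom m) :=
  m.toSyn.injective.comp (Finsupp.mapDomain_injective Sum.inr_injective)

theorem varsHom_monotone {n N : ℕ} (m : MonomialOrder (Fin n ⊕ Fin N)) :
    Monotone (varsHom m) :=
  m.toSyn_monotone.comp fun _ _ h => Finsupp.mapDomain_mono h

/-- The restriction of a monomial order to the monomials in the variables alone. -/
noncomputable def varsOrder {n N : ℕ} (m : MonomialOrder (Fin n ⊕ Fin N)) :
    MonomialOrder (Fin N) where
  syn := AddMonoidHom.mrange (varsHom m)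
  addCommMonoidSyn := AddSubmonoid.toAddCommMonoid _
  linearOrderSyn := Subtype.instLinearOrder _
  toSyn :=
    { Equiv.ofBijective (varsHom m).mrangeRestrict
        ⟨fun _ _ h => varsHom_injective m (congrArg Subtype.val h),
          (varsHom m).mrangeRestrict_surjective⟩ with
      map_add' := fun a b => Subtype.ext ((varsHom m).map_add a b) }
  toSyn_monotone := fun _ _ h => varsHom_monotone m h

/-! ### Templates -/

/-- A template: a polynomial in `x` whose coefficients are linear expressions, without constant
term, in the parameters. It is seen as a polynomial in parameters and variables. -/
def IsTemplate {n N : ℕ} (π : MvPolynomial (Fin n ⊕ Fin N) ℝ) : Prop :=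
  ∀ d ∈ π.support, ∑ i, d (Sum.inl i) = 1

/-- `π[v]`: the parameters are replaced by the real numbers `v`. -/
noncomputable def subst {n N : ℕ} (π : MvPolynomial (Fin n ⊕ Fin N) ℝ) (v : Fin n → ℝ) :
    MvPolynomial (Fin N) ℝ :=
  aeval (Sum.elim (fun i => C (v i)) X) π

/-- The formal Lie derivative of a template; parameters are treated as constants. -/
noncomputable def templateLie {n N : ℕ} (F : VectorField N)
    (π : MvPolynomial (Fin n ⊕ Fin N) ℝ) : MvPolynomial (Fin n ⊕ Fin N) ℝ :=
  ∑ i, pderiv (Sum.inr i) π * rename Sum.inr (F i)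

/-- The `j`-th formal Lie derivative of a template. -/
noncomputable def iterLie {n N : ℕ} (F : VectorField N) (π : MvPolynomial (Fin n ⊕ Fin N) ℝ)
    (j : ℕ) : MvPolynomial (Fin n ⊕ Fin N) ℝ :=
  (templateLie F)^[j] π

/-! ### The algorithm POST -/

/-- The space of valuations `V_i = {v | r_j[v] = 0 for j = 0, …, i}`, with
`r_j = π^(j) mod G`, the division being done in the polynomials in parameters and variables. -/
def postV {n N : ℕ} (m : MonomialOrder (Fin n ⊕ Fin N)) (F : VectorField N)
    (G : Set (MvPolynomial (Fin N) ℝ)) (π : MvPolynomial (Fin n ⊕ Fin N) ℝ) (i : ℕ) :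
    Set (Fin n → ℝ) :=
  {v | ∀ j ≤ i, subst (remainder m (rename Sum.inr '' G) (iterLie F π j)) v = 0}

/-- The ideal `J_i` generated by the union of the sets `π^(j)[V_i]` for `j = 0, …, i`. -/
noncomputable def postJ {n N : ℕ} (m : MonomialOrder (Fin n ⊕ Fin N)) (F : VectorField N)
    (G : Set (MvPolynomial (Fin N) ℝ)) (π : MvPolynomial (Fin n ⊕ Fin N) ℝ) (i : ℕ) :
    Ideal (MvPolynomial (Fin N) ℝ) :=
  Ideal.span (⋃ j ≤ i, subst (iterLie F π j) '' postV m F G π i)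

/-- The algorithm POST, run with the basis `G` and the template `π`, stops and returns `(V, J)`:
these are `V_k` and `J_k` for the least `k` with `V_{k+1} = V_k` and `J_{k+1} = J_k`. -/
def PostReturns {n N : ℕ} (m : MonomialOrder (Fin n ⊕ Fin N)) (F : VectorField N)
    (G : Set (MvPolynomial (Fin N) ℝ)) (π : MvPolynomial (Fin n ⊕ Fin N) ℝ)
    (V : Set (Fin n → ℝ)) (J : Ideal (MvPolynomial (Fin N) ℝ)) : Prop :=
  ∃ k, IsLeast {i | postV m F G π (i + 1) = postV m F G π i ∧
      postJ m F G π (i + 1) = postJ m F G π i} k ∧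
    V = postV m F G π k ∧ J = postJ m F G π k

end PolySafety

open PolySafety

open MvPolynomial

namespace PolySafety

variable {n N : ℕ}

/-! ### The Lie derivative -/

/-! Everything rests on one fact: an invariant ideal `J` that vanishes on `ψ` lies in `I_ψ`. For `p
∈ J` all iterated Lie derivatives of `p` stay in `J`, hence vanish at `x₀ ∈ ψ`. They are the
derivatives at `0` of the analytic function `p(x(t))`, which is therefore zero on the whole interval
of convergence (`IsTimeTrajectory.eval_eq_zero`, `IsInvariantIdeal.le_postIdeal`).

The ideal returned by POST is of this kind. Zero remainders put its generators in `I`, which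
vanishes on `ψ` (`postJ_le_span`), and one simultaneous repetition of `V_i` and `J_i` already gives
invariance (`isInvariantIdeal_postJ`).

Termination is Hilbert's basis theorem applied twice: to the descending varieties `V_i`, then to the
ideals `J_i`, which ascend once `V_i` is constant. -/

theorem lie_C (F : VectorField N) (r : ℝ) : lie F (C r) = 0 := by
  simp [lie]

theorem lie_X (F : VectorField N) (i : Fin N) : lie F (X i) = F i := by
  classical
  simp [lie, pderiv_X, Pi.single_apply]

theorem lie_add (F : VectorField N) (p q : MvPolynomial (Fin N) ℝ) :
    lie F (p + q) = lie F p + lie F q := by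
  simp [lie, add_mul, Finset.sum_add_distrib]

theorem lie_mul (F : VectorField N) (p q : MvPolynomial (Fin N) ℝ) :
    lie F (p * q) = p * lie F q + q * lie F p := by
  simp only [lie, Derivation.leibniz, smul_eq_mul, add_mul, Finset.sum_add_distrib,
    Finset.mul_sum, mul_assoc]

theorem templateLie_add (F : VectorField N) (p q : MvPolynomial (Fin n ⊕ Fin N) ℝ) :
    templateLie F (p + q) = templateLie F p + templateLie F q := by
  simp [templateLie, add_mul, Finset.sum_add_distrib]

theorem templateLie_mul (F : VectorField N) (p q : MvPolynomial (Fin n ⊕ Fin N) ℝ) :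
    templateLie F (p * q) = p * templateLie F q + q * templateLie F p := by
  simp only [templateLie, Derivation.leibniz, smul_eq_mul, add_mul, Finset.sum_add_distrib,
    Finset.mul_sum, mul_assoc]

theorem subst_rename_inr (p : MvPolynomial (Fin N) ℝ) (v : Fin n → ℝ) :
    subst (rename Sum.inr p) v = p := by
  simp only [subst, aeval_rename]
  exact aeval_X_left_apply p

/-- Replacing the parameters by real numbers commutes with taking Lie derivatives. -/
theorem subst_templateLie (F : VectorField N) (π : MvPolynomial (Fin n ⊕ Fin N) ℝ)
    (v : Fin n → ℝ) : subst (templateLie F π) v = lie F (subst π v) := by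
  classical
  induction π using MvPolynomial.induction_on with
  | C r => simp [templateLie, subst, lie, algebraMap_eq]
  | add p q hp hq =>
    rw [templateLie_add]
    simp only [subst, map_add, lie_add] at hp hq ⊢
    rw [hp, hq]
  | mul_X p s hp =>
    have hX : subst (templateLie F (X s)) v = lie F (subst (X s) v) := by
      cases s with
      | inl i => simp [templateLie, subst, lie_C, pderiv_X]
      | inr i =>
        have : templateLie F (X (Sum.inr i) : MvPolynomial (Fin n ⊕ Fin N) ℝ) =
            rename Sum.inr (F i) := by
          simp [templateLie, pderiv_X, Pi.single_apply]
        rw [this, subst_rename_inr]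
        simp [subst, lie_X]
    rw [templateLie_mul]
    simp only [subst, map_add, map_mul, lie_mul] at hp hX ⊢
    rw [hp, hX]

theorem subst_iterLie_succ (F : VectorField N) (π : MvPolynomial (Fin n ⊕ Fin N) ℝ) (j : ℕ)
    (v : Fin n → ℝ) : subst (iterLie F π (j + 1)) v = lie F (subst (iterLie F π j) v) := by
  rw [iterLie, Function.iterate_succ_apply', subst_templateLie, iterLie]

/-- The Lie derivative is not linear over the polynomial ring, but the extra Leibniz term `p * lie F
a` is a multiple of `p` and so stays in the ideal. -/
theorem isInvariantIdeal_span {F : VectorField N} {S : Set (MvPolynomial (Fin N) ℝ)}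
    (h : ∀ p ∈ S, lie F p ∈ Ideal.span S) : IsInvariantIdeal F (Ideal.span S) := by
  intro p hp
  induction hp using Submodule.span_induction with
  | mem p hp => exact h p hp
  | zero => simp [lie]
  | add p q _ _ hp hq => rw [lie_add]; exact add_mem hp hq
  | smul a p hp' hp =>
    rw [smul_eq_mul, lie_mul]
    exact add_mem (Ideal.mul_mem_left _ _ hp) (Ideal.mul_mem_right _ _ hp')

theorem IsInvariantIdeal.iterate_lie_mem {F : VectorField N}
    {J : Ideal (MvPolynomial (Fin N) ℝ)} (hJ : IsInvariantIdeal F J)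
    {p : MvPolynomial (Fin N) ℝ} (hp : p ∈ J) (k : ℕ) : (lie F)^[k] p ∈ J := by
  induction k with
  | zero => exact hp
  | succ k ih => rw [Function.iterate_succ_apply']; exact hJ _ ih

/-! ### Polynomials along trajectories -/

theorem hasDerivAt_eval {F : VectorField N} {x : ℝ → Fin N → ℝ} {t : ℝ}
    (hx : HasDerivAt x (F.toFun (x t)) t) (p : MvPolynomial (Fin N) ℝ) :
    HasDerivAt (fun t => eval (x t) p) (eval (x t) (lie F p)) t := by
  induction p using MvPolynomial.induction_on with
  | C r => simpa [lie_C] using hasDerivAt_const t r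
  | add p q hp hq =>
    simp only [map_add, lie_add]
    exact hp.add hq
  | mul_X p i hp =>
    have := hp.mul (hasDerivAt_pi.mp hx i)
    simp only [eval_mul, eval_X, lie_mul, lie_X, eval_add]
    refine this.congr_deriv ?_
    simp only [VectorField.toFun]
    ring

theorem analyticAt_eval {x : ℝ → Fin N → ℝ} {t : ℝ} (hx : AnalyticAt ℝ x t)
    (p : MvPolynomial (Fin N) ℝ) : AnalyticAt ℝ (fun t => eval (x t) p) t := by
  induction p using MvPolynomial.induction_on with
  | C r => simpa using analyticAt_const
  | add p q hp hq =>
    simp only [map_add]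
    exact hp.add hq
  | mul_X p i hp =>
    simp only [eval_mul, eval_X]
    exact hp.mul (((ContinuousLinearMap.proj (R := ℝ) (φ := fun _ : Fin N => ℝ) i).analyticAt
      (x t)).comp hx)

theorem eventuallyEq_zero_of_iteratedDeriv_eq_zero {g : ℝ → ℝ} {t : ℝ} (hg : AnalyticAt ℝ g t)
    (h : ∀ k, iteratedDeriv k g t = 0) : g =ᶠ[nhds t] 0 := by
  have hs := hg.hasFPowerSeriesAt
  have h0 : (FormalMultilinearSeries.ofScalars ℝ
      fun k => iteratedDeriv k g t / (k.factorial : ℝ)) = 0 := by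
    ext k
    simp [h, FormalMultilinearSeries.ofScalars]
  rw [h0] at hs
  exact hs.eventually_eq_zero

/-- A polynomial whose iterated Lie derivatives all vanish at the initial point vanishes along the
whole trajectory. -/
theorem IsTimeTrajectory.eval_eq_zero {F : VectorField N} {x₀ : Fin N → ℝ}
    {x : ℝ → Fin N → ℝ} {s : FormalMultilinearSeries ℝ ℝ (Fin N → ℝ)}
    (hx : IsTimeTrajectory F x₀ x s) {p : MvPolynomial (Fin N) ℝ}
    (hp : ∀ k, eval x₀ ((lie F)^[k] p) = 0) {t : ℝ} (ht : t ∈ timeDomain s) :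
    eval (x t) p = 0 := by
  obtain ⟨ε, hε, hsol⟩ := hx.solves
  -- Only a germ identity: the differential equation is assumed just on `(-ε, ε)`. The identity
  -- theorem for analytic functions carries the vanishing to all of `timeDomain s`.
  have hderiv : ∀ k, iteratedDeriv k (fun t => eval (x t) p) =ᶠ[nhds 0]
      fun t => eval (x t) ((lie F)^[k] p) := by
    intro k
    induction k with
    | zero => rw [iteratedDeriv_zero]; rfl
    | succ k ih =>
      rw [iteratedDeriv_succ]
      refine ih.deriv.trans ?_
      filter_upwards [Ioo_mem_nhds (neg_lt_zero.mpr hε) hε] with t ht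
      rw [(hasDerivAt_eval (hsol t ht) _).deriv, Function.iterate_succ_apply']
  have hana : AnalyticOnNhd ℝ (fun t => eval (x t) p) (timeDomain s) :=
    fun t ht => analyticAt_eval (hx.taylor.analyticOnNhd t ht) p
  have h0 : (0 : ℝ) ∈ timeDomain s := Metric.mem_eball_self hx.taylor.r_pos
  have hconn : IsPreconnected (timeDomain s) := by
    rw [timeDomain]
    induction s.radius with
    | top => rw [Metric.eball_top]; exact isPreconnected_univ
    | coe r => rw [Metric.eball_coe]; exact (convex_ball _ _).isPreconnected
  refine hana.eqOn_zero_of_preconnected_of_eventuallyEq_zero hconn h0 ?_ ht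
  refine eventuallyEq_zero_of_iteratedDeriv_eq_zero (hana 0 h0) fun k => ?_
  rw [(hderiv k).eq_of_nhds, hx.initial, hp k]

/-- The real zeros of an invariant ideal that vanishes on `ψ` are a postcondition of `ψ`. -/
theorem safe_variety_of_isInvariantIdeal {F : VectorField N} {ψ : Set (Fin N → ℝ)}
    {J : Ideal (MvPolynomial (Fin N) ℝ)} (hJ : IsInvariantIdeal F J)
    (hψ : J ≤ vanishingIdeal ℝ ψ) : Safe F ψ (variety (J : Set (MvPolynomial (Fin N) ℝ))) := by
  intro x₀ hx₀ x s hx t ht p hp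
  refine hx.eval_eq_zero (fun k => ?_) ht
  have := mem_vanishingIdeal_iff.mp (hψ (hJ.iterate_lie_mem hp k)) x₀ hx₀
  simpa [aeval_eq_eval] using this

/-- The zero set of `J` is one of the varieties intersected in `strongestPost`, so it contains the
strongest postcondition. -/
theorem IsInvariantIdeal.le_postIdeal {F : VectorField N} {ψ : Set (Fin N → ℝ)}
    {J : Ideal (MvPolynomial (Fin N) ℝ)} (hJ : IsInvariantIdeal F J)
    (hψ : J ≤ vanishingIdeal ℝ ψ) : J ≤ postIdeal F ψ := by
  intro p hp
  refine mem_vanishingIdeal_iff.mpr fun x hx => ?_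
  have := hx _ ⟨⟨_, rfl⟩, safe_variety_of_isInvariantIdeal hJ hψ⟩ p hp
  simpa [aeval_eq_eval] using this

/-! ### The spaces of valuations and the ideals computed by POST -/

/-- The elements of `G` contain no parameters, so substituting `v` in the division identity leaves
them fixed and turns the quotients into polynomials in `x`. -/
theorem subst_mem_of_subst_remainder_eq_zero (m : MonomialOrder (Fin n ⊕ Fin N))
    {G : Set (MvPolynomial (Fin N) ℝ)} {p : MvPolynomial (Fin n ⊕ Fin N) ℝ} {v : Fin n → ℝ}
    (h : subst (remainder m (rename Sum.inr '' G) p) v = 0) : subst p v ∈ Ideal.span G := by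
  obtain ⟨⟨q, hq, -⟩, -⟩ := Classical.choose_spec (exists_isRemainder m (rename Sum.inr '' G) p)
  change p = _ + remainder m (rename Sum.inr '' G) p at hq
  have hsubst : subst p v =
      subst (q.sum fun g q => q * (g : MvPolynomial (Fin n ⊕ Fin N) ℝ)) v := by
    conv_lhs => rw [hq]
    simp only [subst, map_add] at h ⊢
    rw [h, add_zero]
  rw [hsubst, subst, Finsupp.sum, map_sum]
  refine sum_mem fun g _ => ?_
  obtain ⟨-, p, hp, rfl⟩ := g
  rw [map_mul]
  refine Ideal.mul_mem_left _ _ ?_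
  change subst (rename Sum.inr p) v ∈ _
  rw [subst_rename_inr]
  exact Ideal.subset_span hp

/-- The coefficients of `p[v]` are polynomials in `v`. -/
theorem exists_eval_eq_coeff_subst (p : MvPolynomial (Fin n ⊕ Fin N) ℝ) (d : Fin N →₀ ℕ) :
    ∃ q : MvPolynomial (Fin n) ℝ, ∀ v, eval v q = coeff d (subst p v) := by
  -- Regard `p` as a polynomial in `x` over `ℝ[a]`; evaluating its coefficients at `v` gives `p[v]`.
  refine ⟨coeff d (aeval (Sum.elim (fun i => C (X i)) X) p), fun v => ?_⟩
  rw [← coeff_map]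
  congr 1
  induction p using MvPolynomial.induction_on with
  | C r => simp [subst, MvPolynomial.algebraMap_apply, algebraMap_eq]
  | add p q hp hq => simp only [subst, map_add] at hp hq ⊢; rw [hp, hq]
  | mul_X p s hp =>
    simp only [subst, map_mul] at hp ⊢
    rw [hp]
    cases s <;> simp

theorem isVariety_postV (m : MonomialOrder (Fin n ⊕ Fin N)) (F : VectorField N)
    (G : Set (MvPolynomial (Fin N) ℝ)) (π : MvPolynomial (Fin n ⊕ Fin N) ℝ) (i : ℕ) :
    IsVariety (postV m F G π i) := by
  choose q hq using exists_eval_eq_coeff_subst (n := n) (N := N)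
  refine ⟨{f | ∃ j ≤ i, ∃ d, f = q (remainder m (rename Sum.inr '' G) (iterLie F π j)) d}, ?_⟩
  ext v
  constructor
  · rintro hv _ ⟨j, hj, d, rfl⟩
    rw [hq, hv j hj, coeff_zero]
  · intro hv j hj
    ext d
    rw [← hq, coeff_zero]
    exact hv _ ⟨j, hj, d, rfl⟩

/-- A variety is recovered from its ideal, so stabilization of the ideals forces that of the
varieties. -/
theorem IsVariety.eq_zeroLocus_vanishingIdeal {A : Set (Fin n → ℝ)} (hA : IsVariety A) :
    A = zeroLocus ℝ (vanishingIdeal ℝ A) := by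
  obtain ⟨P, rfl⟩ := hA
  refine Set.Subset.antisymm (fun x hx p hp => mem_vanishingIdeal_iff.mp hp x hx) ?_
  intro x hx p hp
  have := hx p (mem_vanishingIdeal_iff.mpr fun y hy => by simpa [aeval_eq_eval] using hy p hp)
  simpa [aeval_eq_eval] using this

/-- Descending chains of real algebraic varieties are eventually constant. -/
theorem eventually_const_of_antitone_isVariety {A : ℕ → Set (Fin n → ℝ)} (hA : Antitone A)
    (hvar : ∀ i, IsVariety (A i)) : ∃ k, ∀ i ≥ k, A i = A k := by
  obtain ⟨k, hk⟩ := monotone_stabilizes_iff_noetherian.mpr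
    (inferInstance : IsNoetherian (MvPolynomial (Fin n) ℝ) (MvPolynomial (Fin n) ℝ))
    ⟨fun i => vanishingIdeal ℝ (A i), fun i j hij => vanishingIdeal_anti_mono (hA hij)⟩
  refine ⟨k, fun i hi => ?_⟩
  rw [(hvar i).eq_zeroLocus_vanishingIdeal, (hvar k).eq_zeroLocus_vanishingIdeal]
  exact congrArg (zeroLocus ℝ) (hk i hi).symm

theorem postV_antitone (m : MonomialOrder (Fin n ⊕ Fin N)) (F : VectorField N)
    (G : Set (MvPolynomial (Fin N) ℝ)) (π : MvPolynomial (Fin n ⊕ Fin N) ℝ) :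
    Antitone (postV m F G π) :=
  fun _ _ hij _ hv j hj => hv j (hj.trans hij)

theorem subst_iterLie_mem_postJ (m : MonomialOrder (Fin n ⊕ Fin N)) (F : VectorField N)
    (G : Set (MvPolynomial (Fin N) ℝ)) (π : MvPolynomial (Fin n ⊕ Fin N) ℝ) {i j : ℕ}
    (hj : j ≤ i) {v : Fin n → ℝ} (hv : v ∈ postV m F G π i) :
    subst (iterLie F π j) v ∈ postJ m F G π i :=
  Ideal.subset_span (Set.mem_biUnion (show j ∈ {j | j ≤ i} from hj) ⟨v, hv, rfl⟩)

theorem postJ_le_iff (m : MonomialOrder (Fin n ⊕ Fin N)) (F : VectorField N)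
    (G : Set (MvPolynomial (Fin N) ℝ)) (π : MvPolynomial (Fin n ⊕ Fin N) ℝ) {i : ℕ}
    {K : Ideal (MvPolynomial (Fin N) ℝ)} :
    postJ m F G π i ≤ K ↔ ∀ j ≤ i, ∀ v ∈ postV m F G π i, subst (iterLie F π j) v ∈ K := by
  simp only [postJ, Ideal.span_le, Set.iUnion_subset_iff, Set.image_subset_iff]
  rfl

theorem postJ_le_span (m : MonomialOrder (Fin n ⊕ Fin N)) (F : VectorField N)
    (G : Set (MvPolynomial (Fin N) ℝ)) (π : MvPolynomial (Fin n ⊕ Fin N) ℝ) (i : ℕ) :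
    postJ m F G π i ≤ Ideal.span G :=
  (postJ_le_iff m F G π).mpr fun j hj _ hv => subst_mem_of_subst_remainder_eq_zero m (hv j hj)

/-- Termination of POST. -/
theorem exists_postReturns (m : MonomialOrder (Fin n ⊕ Fin N)) (F : VectorField N)
    (G : Set (MvPolynomial (Fin N) ℝ)) (π : MvPolynomial (Fin n ⊕ Fin N) ℝ) :
    ∃ V J, PostReturns m F G π V J := by
  classical
  obtain ⟨k, hk⟩ := eventually_const_of_antitone_isVariety (postV_antitone m F G π)
    (isVariety_postV m F G π)
  have hV : ∀ i, postV m F G π (k + i) = postV m F G π k := fun i => hk _ (Nat.le_add_right k i)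
  -- The ideals need not ascend while `V_i` still shrinks, since generators may be lost; hence the
  -- shift by `k`.
  have hmono : Monotone fun i => postJ m F G π (k + i) := by
    refine fun i j hij => (postJ_le_iff m F G π).mpr fun l hl v hv => ?_
    refine subst_iterLie_mem_postJ m F G π (by omega) ?_
    rwa [hV] at hv ⊢
  obtain ⟨l, hl⟩ := monotone_stabilizes_iff_noetherian.mpr
    (inferInstance : IsNoetherian (MvPolynomial (Fin N) ℝ) (MvPolynomial (Fin N) ℝ))
    ⟨fun i => postJ m F G π (k + i), hmono⟩
  have hex : ∃ i, postV m F G π (i + 1) = postV m F G π i ∧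
      postJ m F G π (i + 1) = postJ m F G π i :=
    ⟨k + l, (hV (l + 1)).trans (hV l).symm, (hl (l + 1) l.le_succ).symm⟩
  exact ⟨_, _, Nat.find hex, ⟨Nat.find_spec hex, fun i hi => Nat.find_min' hex hi⟩, rfl, rfl⟩

/-- The Lie derivative of a generator `π^(j)[v]` with `j ≤ k` is `π^(j+1)[v]`. Since `v ∈ V_k =
V_{k+1}`, it is a generator of `J_{k+1} = J_k`. -/
theorem isInvariantIdeal_postJ {m : MonomialOrder (Fin n ⊕ Fin N)} {F : VectorField N}
    {G : Set (MvPolynomial (Fin N) ℝ)} {π : MvPolynomial (Fin n ⊕ Fin N) ℝ} {k : ℕ}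
    (hV : postV m F G π (k + 1) = postV m F G π k)
    (hJ : postJ m F G π (k + 1) = postJ m F G π k) : IsInvariantIdeal F (postJ m F G π k) := by
  refine isInvariantIdeal_span fun p hp => ?_
  obtain ⟨j, hj, v, hv, rfl⟩ := Set.mem_iUnion₂.mp hp
  rw [← subst_iterLie_succ]
  change _ ∈ postJ m F G π k
  rw [← hJ]
  exact subst_iterLie_mem_postJ m F G π (Nat.succ_le_succ hj) (hV ▸ hv)

end PolySafety

theorem theorem2 {n N : ℕ} (F : VectorField N)
    (m : MonomialOrder (Fin n ⊕ Fin N)) (hm : IsEliminationOrder m)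
    (ψ : Set (Fin N → ℝ)) (hψ : IsVariety ψ)
    (π : MvPolynomial (Fin n ⊕ Fin N) ℝ) (hπ : IsTemplate π)
    (I : Ideal (MvPolynomial (Fin N) ℝ)) (hI : I ≤ vanishingIdeal ℝ ψ)
    (G : Set (MvPolynomial (Fin N) ℝ)) (hG : IsGroebnerBasis (varsOrder m) G I) :
    (∃ V J, PostReturns m F G π V J) ∧
    ∀ V J, PostReturns m F G π V J →
      (subst π '' V ⊆ Set.range (subst π) ∩ postIdeal F ψ ∧
        Safe F ψ (variety (subst π '' V))) ∧
      (IsInvariantIdeal F J ∧ subst π '' V ⊆ J ∧ J ≤ postIdeal F ψ) := by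
  refine ⟨exists_postReturns m F G π, ?_⟩
  rintro V J ⟨k, ⟨⟨hV, hJ⟩, -⟩, rfl, rfl⟩
  have hinv := isInvariantIdeal_postJ hV hJ
  have hvan : postJ m F G π k ≤ vanishingIdeal ℝ ψ :=
    (postJ_le_span m F G π k).trans (hG.span_eq.trans_le hI)
  have hmem : subst π '' postV m F G π k ⊆ postJ m F G π k := by
    rintro _ ⟨v, hv, rfl⟩
    exact subst_iterLie_mem_postJ m F G π k.zero_le hv
  have hle := hinv.le_postIdeal hvan
  refine ⟨⟨Set.subset_inter (Set.image_subset_range _ _) (hmem.trans hle), ?_⟩, hinv, hmem, hle⟩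
  intro x₀ hx₀ x s hx t ht p hp
  -- As `π[V] ⊆ J`, the zeros of `J` are zeros of `π[V]`.
  exact safe_variety_of_isInvariantIdeal hinv hvan x₀ hx₀ x s hx t ht p (hmem hp)
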